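/- Let $p$ be an odd prime, let $s>1$ and $0<i<s$ be integers, and put $q=p^s$, $h=\frac{p^i-1}{2}$ and $m=\gcd(i,s)$. Let $\beta\in\mathbb{F}_{q^2}$ be a primitive $(q+1)$-th root of unity, and let $\mathcal{C}_{(q,q+1,3,h)}$ be the BCH code over $\mathbb{F}_q$ of length $q+1$ and designed distance $3$, that is, the cyclic code (ideal of $\mathbb{F}_q[x]/(x^{q+1}-1)$) generated by $\mathrm{lcm}(M_{\beta^h}(x),M_{\beta^{h+1}}(x))$, where $M_\gamma(x)$ denotes the minimal polynomial of $\gamma$ over $\mathbb{F}_q$. Then the dual code $\mathcal{C}^{\perp}_{(q,q+1,3,h)}$ is a four-weight code (its nonzero codewords have exactly four different Hamming weights) with parameters $[q+1,4,q-p^m]$, i.e. it has length $q+1$, dimension $4$ and minimum distance $q-p^m$. -/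

import Mathlib

open Polynomial

/-- The cyclic code of length `n` over `F` generated by `g`: the words `(c₀, …, c_{n-1})` whose
polynomial `c₀ + c₁ x + ⋯ + c_{n-1} x^{n-1}` lies in the ideal generated by `g` in
`F[x] / (x^n - 1)`. -/
noncomputable def cyclicCode {F : Type*} [Field F] (n : ℕ) (g : F[X]) :
    Submodule F (Fin n → F) :=
  ((Ideal.span {AdjoinRoot.mk (X ^ n - 1 : F[X]) g}).restrictScalars F).comap
    (Fintype.linearCombination F
      (fun i : Fin n => AdjoinRoot.root (X ^ n - 1 : F[X]) ^ (i : ℕ)))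

/-- The generator polynomial of a BCH code: the least common multiple over `F` of the minimal
polynomials over `F` of `β ^ h, β ^ (h + 1), …, β ^ (h + δ - 2)`. -/
noncomputable def bchGenerator (F : Type*) {E : Type*} [Field F] [DecidableEq F] [Field E]
    [Algebra F E] (β : E) (δ h : ℕ) : F[X] :=
  (Finset.range (δ - 1)).lcm (fun j => minpoly F (β ^ (h + j)))

/-- The BCH code of length `n` and designed distance `δ` over `F`, with offset `h`, formed with
the `n`-th root of unity `β` in an extension field `E` of `F`. -/
noncomputable def bchCode (F : Type*) {E : Type*} [Field F] [DecidableEq F] [Field E]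
    [Algebra F E] (β : E) (n δ h : ℕ) : Submodule F (Fin n → F) :=
  cyclicCode n (bchGenerator F β δ h)

/-- The (Euclidean) dual of a linear code. -/
def dualCode {F : Type*} [Field F] {n : ℕ} (C : Submodule F (Fin n → F)) :
    Submodule F (Fin n → F) :=
  C.orthogonalBilin (dotProductBilin F F)

/-- The set of Hamming weights of the nonzero codewords of a linear code. -/
def nonzeroWeights {F : Type*} [Field F] [DecidableEq F] {n : ℕ}
    (C : Submodule F (Fin n → F)) : Set ℕ :=
  {w | ∃ c ∈ C, c ≠ 0 ∧ hammingNorm c = w}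

/-- A linear code of length `n` has parameters `[n, k, d]`: its dimension is `k` and its minimum
distance, the least Hamming weight of a nonzero codeword, is `d`. -/
def HasParameters {F : Type*} [Field F] [DecidableEq F] {n : ℕ}
    (C : Submodule F (Fin n → F)) (k d : ℕ) : Prop :=
  Module.finrank F C = k ∧ IsLeast (nonzeroWeights C) d

/-- A `t`-weight code: its nonzero codewords have exactly `t` different Hamming weights. -/
def IsWeightCode {F : Type*} [Field F] [DecidableEq F] {n : ℕ} (t : ℕ)
    (C : Submodule F (Fin n → F)) : Prop :=
  (nonzeroWeights C).ncard = t

/-! By nondegeneracy of the trace form, the dual code consists of the words Tr(a x^h + b x^(h+1)),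
with x running over the (q+1)-th roots of unity (`dualCode_bchCode_three`). There x^q = 1/x, so with
Q = 2h+1 = p^i an entry vanishes exactly at a root of b x^(Q+1) + a x^Q + a^q x + b^q; the weight is
q+1-N, with N the number of such roots.

For (a,b) ≠ 0, N ≤ Q+1 < q+1, so the parametrization is injective and the dimension is 4. Writing x
= w^(q-1) turns roots into isotropic F-lines of a form B on E. If three lines are isotropic, B
becomes (c^Q d - d^Q c) B(u,v) in a suitable basis, and its isotropic lines form a projective line
over the field of p^m elements (`ncard_unitCircleZeros_of_two_lt`). Hence N is 0, 1, 2 or p^m+1, and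
all four occur. -/

/-! ### The dual code as a trace code -/

theorem mem_cyclicCode_iff {F : Type*} [Field F] {n : ℕ} {g : F[X]} (hg : g ∣ X ^ n - 1)
    (c : Fin n → F) : c ∈ cyclicCode n g ↔ g ∣ ∑ j, C (c j) * X ^ (j : ℕ) := by
  have key : Fintype.linearCombination F
      (fun j : Fin n => AdjoinRoot.root (X ^ n - 1 : F[X]) ^ (j : ℕ)) c =
      AdjoinRoot.mk (X ^ n - 1) (∑ j, C (c j) * X ^ (j : ℕ)) := by
    simp [Fintype.linearCombination_apply, Algebra.smul_def, AdjoinRoot.algebraMap_eq]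
  rw [cyclicCode, Submodule.mem_comap, key, Submodule.restrictScalars_mem,
    Ideal.mem_span_singleton]
  constructor
  · rintro ⟨r, hr⟩
    obtain ⟨r, rfl⟩ := AdjoinRoot.mk_surjective r
    rw [← map_mul, AdjoinRoot.mk_eq_mk] at hr
    have := (hg.trans hr).add (dvd_mul_right g r)
    simpa using this
  · exact fun h => map_dvd _ h

theorem bchGenerator_three_dvd_iff {F E : Type*} [Field F] [DecidableEq F] [Field E]
    [Algebra F E] (β : E) (h : ℕ) (P : F[X]) :
    bchGenerator F β 3 h ∣ P ↔ aeval (β ^ h) P = 0 ∧ aeval (β ^ (h + 1)) P = 0 := by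
  rw [bchGenerator, Finset.lcm_dvd_iff, ← minpoly.dvd_iff, ← minpoly.dvd_iff]
  simp only [Finset.mem_range]
  exact ⟨fun H => ⟨H 0 (by norm_num), H 1 (by norm_num)⟩, fun H j hj => by
    interval_cases j
    exacts [H.1, H.2]⟩

theorem mem_bchCode_three_iff {F E : Type*} [Field F] [DecidableEq F] [Field E]
    [Algebra F E] {β : E} {n : ℕ} (hβ : β ^ n = 1) (h : ℕ) (c : Fin n → F) :
    c ∈ bchCode F β n 3 h ↔ ∑ j, algebraMap F E (c j) * (β ^ (j : ℕ)) ^ h = 0 ∧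
      ∑ j, algebraMap F E (c j) * (β ^ (j : ℕ)) ^ (h + 1) = 0 := by
  have hroot : ∀ k, (β ^ k) ^ n = 1 := fun k => by rw [← pow_mul, mul_comm, pow_mul, hβ, one_pow]
  rw [bchCode, mem_cyclicCode_iff, bchGenerator_three_dvd_iff]
  · simp only [map_sum, map_mul, aeval_C, map_pow, aeval_X]
    simp only [pow_right_comm β]
  · rw [bchGenerator_three_dvd_iff]
    simp [hroot]

/-- The word whose entry at `j` is the trace of `a x ^ h + b x ^ (h + 1)` with `x = β ^ j`, as a
linear function of `(a, b)`. -/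
noncomputable def traceWord (F : Type*) {E : Type*} [Field F] [Field E] [Algebra F E]
    (β : E) (n h : ℕ) : (E × E) →ₗ[F] (Fin n → F) :=
  LinearMap.pi fun j => (Algebra.trace F E).comp
    (((LinearMap.mulRight F ((β ^ (j : ℕ)) ^ h)).comp (LinearMap.fst F E E)) +
      ((LinearMap.mulRight F ((β ^ (j : ℕ)) ^ (h + 1))).comp (LinearMap.snd F E E)))

theorem traceWord_apply {F E : Type*} [Field F] [Field E] [Algebra F E]
    (β : E) (n h : ℕ) (a b : E) (j : Fin n) : traceWord F β n h (a, b) j =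
      Algebra.trace F E (a * (β ^ (j : ℕ)) ^ h + b * (β ^ (j : ℕ)) ^ (h + 1)) := rfl

theorem dotProduct_traceWord {F E : Type*} [Field F] [Field E] [Algebra F E]
    (β : E) (n h : ℕ) (a b : E) (c : Fin n → F) : traceWord F β n h (a, b) ⬝ᵥ c =
      Algebra.trace F E (a * ∑ j, algebraMap F E (c j) * (β ^ (j : ℕ)) ^ h +
        b * ∑ j, algebraMap F E (c j) * (β ^ (j : ℕ)) ^ (h + 1)) := by
  rw [Finset.mul_sum, Finset.mul_sum, ← Finset.sum_add_distrib, map_sum, dotProduct]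
  refine Finset.sum_congr rfl fun j _ => ?_
  rw [traceWord_apply, mul_comm, ← smul_eq_mul, ← map_smul, Algebra.smul_def]
  congr 1
  ring

/-- Pairing c with all trace words tests its two syndromes against every a and b under the trace
form, which is nondegenerate. -/
theorem bchCode_three_eq_orthogonal {F E : Type*} [Field F] [DecidableEq F] [Field E]
    [Algebra F E] [FiniteDimensional F E] [Algebra.IsSeparable F E] {β : E} {n : ℕ}
    (hβ : β ^ n = 1) (h : ℕ) :
    bchCode F β n 3 h = dualCode (LinearMap.range (traceWord F β n h)) := by
  have nondeg : ∀ z : E, (∀ a, Algebra.trace F E (a * z) = 0) → z = 0 := fun z hz =>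
    (traceForm_nondegenerate F E).2 z fun a => hz a
  ext c
  rw [mem_bchCode_three_iff hβ, dualCode, Submodule.mem_orthogonalBilin_iff]
  have hrange : (∀ w ∈ LinearMap.range (traceWord F β n h), dotProductBilin F F w c = 0) ↔
      ∀ a b, traceWord F β n h (a, b) ⬝ᵥ c = 0 :=
    ⟨fun H a b => H _ ⟨(a, b), rfl⟩, by rintro H _ ⟨⟨a, b⟩, rfl⟩; exact H a b⟩
  rw [hrange]
  simp only [dotProduct_traceWord]
  constructor
  · rintro ⟨h1, h2⟩ a b
    simp [h1, h2]
  · intro H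
    exact ⟨nondeg _ fun a => by simpa using H a 0, nondeg _ fun b => by simpa using H 0 b⟩

theorem dualCode_dualCode {F : Type*} [Field F] {n : ℕ} (W : Submodule F (Fin n → F)) :
    dualCode (dualCode W) = W := by
  have hrefl : LinearMap.BilinForm.IsRefl (dotProductBilin F F : LinearMap.BilinForm F (Fin n → F)) :=
    fun x y hxy => by simpa [dotProduct_comm] using hxy
  have hnd : LinearMap.BilinForm.Nondegenerate
      (dotProductBilin F F : LinearMap.BilinForm F (Fin n → F)) :=
    ⟨fun x hx => dotProduct_eq_zero _ fun y => hx y,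
      fun x hx => dotProduct_eq_zero _ fun y => by rw [dotProduct_comm]; exact hx y⟩
  exact LinearMap.BilinForm.orthogonal_orthogonal hnd hrefl W

theorem dualCode_bchCode_three {F E : Type*} [Field F] [DecidableEq F] [Field E]
    [Algebra F E] [FiniteDimensional F E] [Algebra.IsSeparable F E] {β : E} {n : ℕ}
    (hβ : β ^ n = 1) (h : ℕ) :
    dualCode (bchCode F β n 3 h) = LinearMap.range (traceWord F β n h) := by
  rw [bchCode_three_eq_orthogonal hβ, dualCode_dualCode]

/-! ### Fixed points of Frobenius powers -/

/-- Besides 0, the solutions are the kernel of a power map on a cyclic group of order p^s - 1, which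
p^m - 1 divides. -/
theorem ncard_pow_eq_self {F : Type*} [Field F] [Fintype F] {p s m : ℕ} (hp : 1 < p) (hm : 0 < m)
    (hms : m ∣ s) (hF : Fintype.card F = p ^ s) : {t : F | t ^ p ^ m = t}.ncard = p ^ m := by
  have hpm : 1 < p ^ m := Nat.one_lt_pow hm.ne' hp
  have hset : {t : F | t ^ p ^ m = t} =
      insert 0 (Units.val '' ((powMonoidHom (p ^ m - 1) : Fˣ →* Fˣ).ker : Set Fˣ)) := by
    ext t
    have hsplit : t ^ p ^ m = t ^ (p ^ m - 1) * t := by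
      rw [← pow_succ, Nat.sub_add_cancel hpm.le]
    simp only [Set.mem_ofPred_eq, Set.mem_insert_iff, Set.mem_image, SetLike.mem_coe,
      MonoidHom.mem_ker, powMonoidHom_apply]
    rw [hsplit]
    constructor
    · intro h
      by_cases ht : t = 0
      · exact Or.inl ht
      · exact Or.inr ⟨Units.mk0 t ht, Units.ext (by simpa [ht] using h), rfl⟩
    · rintro (rfl | ⟨u, hu, rfl⟩)
      · simp
      · rw [← Units.val_pow_eq_pow_val, hu]
        simp
  rw [hset, Set.ncard_insert_of_notMem (by simp), Set.ncard_image_of_injective _ Units.val_injective,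
    ← Nat.card_coe_set_eq]
  have := IsCyclic.card_powMonoidHom_ker Fˣ (p ^ m - 1)
  rw [Nat.card_units, Nat.card_eq_fintype_card (α := F), hF,
    Nat.gcd_eq_right (Nat.pow_sub_one_dvd_pow_sub_one p hms)] at this
  exact (congrArg (· + 1) this).trans (Nat.sub_add_cancel hpm.le)

theorem pow_gcd_eq_self_iff {M : Type*} [Monoid M] {p i s : ℕ} (t : M) (hs : t ^ p ^ s = t) :
    t ^ p ^ Nat.gcd i s = t ↔ t ^ p ^ i = t := by
  have hit : ∀ k, Function.IsPeriodicPt (fun y : M => y ^ p) k t ↔ t ^ p ^ k = t := fun k => by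
    rw [Function.IsPeriodicPt, Function.IsFixedPt, pow_iterate]
  rw [← hit] at hs
  rw [← hit, ← hit]
  exact ⟨fun h => h.trans_dvd (Nat.gcd_dvd_left i s), fun h => h.gcd hs⟩

/-! ### Zeros on the unit circle -/

/-- The zeros of `b x ^ (Q + 1) + a x ^ Q + a ^ q x + b ^ q` on the `(q + 1)`-th roots of unity. -/
def unitCircleZeros {E : Type*} [Field E] (q Q : ℕ) (a b : E) : Set E :=
  {x | x ^ (q + 1) = 1 ∧ b * x ^ (Q + 1) + a * x ^ Q + a ^ q * x + b ^ q = 0}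

theorem ncard_unitCircleZeros_le {E : Type*} [Field E] {q Q : ℕ} (hQ : 1 < Q) {a b : E}
    (hab : (a, b) ≠ 0) : (unitCircleZeros q Q a b).ncard ≤ Q + 1 := by
  classical
  set P : E[X] := C b * X ^ (Q + 1) + C a * X ^ Q + C (a ^ q) * X + C (b ^ q) with hP
  have hP0 : P ≠ 0 := by
    intro h0
    apply hab
    have h1 : P.coeff (Q + 1) = b := by
      simp [hP, -map_pow, coeff_C, coeff_X_pow, show Q ≠ 0 by omega]
    have h2 : P.coeff Q = a := by
      simp [hP, -map_pow, coeff_X, coeff_C, coeff_X_pow, show Q ≠ 0 by omega, show ¬ 1 = Q by omega]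
    rw [h0] at h1 h2
    simp [← h1, ← h2]
  have hdeg : P.natDegree ≤ Q + 1 := by
    rw [hP]
    compute_degree
  have hsub : unitCircleZeros q Q a b ⊆ (P.roots.toFinset : Set E) := fun x hx => by
    rw [Finset.mem_coe, Multiset.mem_toFinset, mem_roots hP0]
    simpa [hP] using hx.2
  calc (unitCircleZeros q Q a b).ncard ≤ (P.roots.toFinset : Set E).ncard :=
        Set.ncard_le_ncard hsub (Finset.finite_toSet _)
    _ ≤ P.roots.card := by
        rw [Set.ncard_coe_finset]; exact Multiset.toFinset_card_le _
    _ ≤ Q + 1 := (card_roots' P).trans hdeg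

section Quadratic

variable {F E : Type*} [Field F] [Fintype F] [Field E] [Algebra F E] {p s i : ℕ} [Fact p.Prime]
  [CharP E p]

theorem pow_card_sq_eq_self {q : ℕ} (hF : Fintype.card F = q) (hE : Module.finrank F E = 2)
    (w : E) : (w ^ q) ^ q = w := by
  have : FiniteDimensional F E := .of_finrank_pos (by omega)
  have : Finite E := Module.finite_of_finite F
  have := Fintype.ofFinite E
  rw [← pow_mul, ← sq, ← hF, ← hE, ← Module.card_eq_pow_finrank, FiniteField.pow_card]

theorem algebraMap_pow_card {q : ℕ} (hF : Fintype.card F = q) (t : F) :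
    algebraMap F E t ^ q = algebraMap F E t := by
  rw [← map_pow, ← hF, FiniteField.pow_card]

/-- Hilbert 90: every y + u^q y^q satisfies the equation. If y = 1 gives zero, then u^q = -1 and y =
β gives β - β^q ≠ 0. -/
theorem exists_pow_eq_mul {q : ℕ} (hq : q = p ^ s) (hsq : ∀ w : E, (w ^ q) ^ q = w)
    {β : E} (hβ : β ^ q ≠ β) {u : E} (hu : u ^ (q + 1) = 1) : ∃ w : E, w ≠ 0 ∧ w ^ q = u * w := by
  have hadd : ∀ x y : E, (x + y) ^ q = x ^ q + y ^ q := fun x y => by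
    rw [hq, add_pow_char_pow]
  have key : ∀ y : E, (y + u ^ q * y ^ q) ^ q = u * (y + u ^ q * y ^ q) := fun y => by
    rw [hadd, mul_pow, hsq, hsq, mul_add, ← mul_assoc, ← pow_succ', hu]
    ring
  by_cases h1 : (1 : E) + u ^ q * 1 ^ q = 0
  · refine ⟨_, fun h2 => hβ ?_, key β⟩
    have : u ^ q = -1 := by linear_combination h1 - u ^ q * (one_pow q : (1 : E) ^ q = 1)
    rw [this] at h2
    linear_combination -h2
  · exact ⟨_, h1, key 1⟩

/-- Three zeros on the unit circle turn the zero set into a projective line over the subfield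
fixed by both Frobenius powers. -/
theorem ncard_unitCircleZeros_of_two_lt {q : ℕ} (hi : 0 < i)
    (hq : q = p ^ s) (hF : Fintype.card F = q) (hE : Module.finrank F E = 2)
    {β : E} (hβ : β ^ q ≠ β) {a b : E} (hcard : 2 < (unitCircleZeros q (p ^ i) a b).ncard)
    {x₀ : E} (hx₀ : x₀ ^ (q + 1) = 1) (hx₀' : x₀ ∉ unitCircleZeros q (p ^ i) a b) :
    (unitCircleZeros q (p ^ i) a b).ncard = p ^ Nat.gcd i s + 1 := by
  have hfd : FiniteDimensional F E := .of_finrank_pos (by omega)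
  have hfin : Finite E := Module.finite_of_finite F
  have hsq := pow_card_sq_eq_self (E := E) hF hE
  have hbar := algebraMap_pow_card (E := E) hF
  have hlift : ∀ u : E, u ^ (q + 1) = 1 → ∃ w : E, w ≠ 0 ∧ w ^ q = u * w :=
    fun u => exists_pow_eq_mul hq hsq hβ
  have haddq : ∀ x y : E, (x + y) ^ q = x ^ q + y ^ q := fun x y => by
    rw [hq, add_pow_char_pow]
  set Q := p ^ i with hQ
  have haddQ : ∀ x y : E, (x + y) ^ Q = x ^ Q + y ^ Q := fun x y => by
    rw [hQ, add_pow_char_pow]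
  have hq0 : q ≠ 0 := by rw [← hF]; exact Fintype.card_ne_zero
  set ι := algebraMap F E with hι
  -- the sesquilinear form whose isotropic lines are the zeros
  let B : E → E → E := fun u v =>
    b * (u ^ q) ^ Q * v ^ q + a * (u ^ q) ^ Q * v + a ^ q * u ^ Q * v ^ q + b ^ q * u ^ Q * v
  have hB : ∀ x w : E, w ^ q = x * w → B w w = w ^ (Q + 1) *
      (b * x ^ (Q + 1) + a * x ^ Q + a ^ q * x + b ^ q) := fun x w hw => by
    simp only [B, hw]
    ring
  have hmem : ∀ x w : E, x ^ (q + 1) = 1 → w ≠ 0 → w ^ q = x * w →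
      (x ∈ unitCircleZeros q Q a b ↔ B w w = 0) := fun x w hx hw0 hw => by
    rw [hB x w hw]
    simp [unitCircleZeros, hx, hw0]
  have hBexp : ∀ (c d : F) (u v : E), B (ι c * u + ι d * v) (ι c * u + ι d * v) =
      ι c ^ (Q + 1) * B u u + ι c ^ Q * ι d * B u v + ι d ^ Q * ι c * B v u +
        ι d ^ (Q + 1) * B v v := fun c d u v => by
    simp only [B, haddq, haddQ, mul_pow, hbar]
    ring
  obtain ⟨x₁, hx₁, x₂, hx₂, x₃, hx₃, h12, h13, h23⟩ := (Set.two_lt_ncard (Set.toFinite _)).1 hcard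
  obtain ⟨w₁, hw₁, hwx₁⟩ := hlift x₁ hx₁.1
  obtain ⟨w₂, hw₂, hwx₂⟩ := hlift x₂ hx₂.1
  obtain ⟨w₃, hw₃, hwx₃⟩ := hlift x₃ hx₃.1
  have hspan : ∀ (x y u v : E), u ≠ 0 → v ≠ 0 → x ≠ y → u ^ q = x * u → v ^ q = y * v →
      ∀ w : E, ∃ c d : F, ι c * u + ι d * v = w := fun x y u v hu hv hxy hux hvy w => by
    -- Raising a relation to the q-th power multiplies its two terms by x ≠ y, so each term can be
    -- eliminated.
    have hli : LinearIndependent F ![u, v] := by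
      rw [LinearIndependent.pair_iff]
      intro c d hcd
      simp only [Algebra.smul_def] at hcd
      have hcd' : ι c * (x * u) + ι d * (y * v) = 0 := by
        rw [← hux, ← hvy, ← hbar c, ← hbar d, ← mul_pow, ← mul_pow, ← haddq, hcd, zero_pow hq0]
      have hc : ι c * ((x - y) * u) = 0 := by linear_combination hcd' - y * hcd
      have hd : ι d * ((y - x) * v) = 0 := by linear_combination hcd' - x * hcd
      constructor
      · simpa [sub_eq_zero, hxy, hu, hι] using hc
      · simpa [sub_eq_zero, hxy.symm, hv, hι] using hd
    have htop := hli.span_eq_top_of_card_eq_finrank (by simp [hE])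
    have hw : w ∈ Submodule.span F (Set.range ![u, v]) := htop ▸ Submodule.mem_top
    rw [Matrix.range_cons_cons_empty, Submodule.mem_span_pair] at hw
    simpa only [Algebra.smul_def] using hw
  obtain ⟨c₁, c₂, hc⟩ := hspan x₁ x₂ w₁ w₂ hw₁ hw₂ h12 hwx₁ hwx₂ w₃
  have hcx : ι c₁ * (x₁ * w₁) + ι c₂ * (x₂ * w₂) = x₃ * w₃ := by
    rw [← hwx₃, ← hc, haddq, mul_pow, mul_pow, hbar, hbar, hwx₁, hwx₂]
  have hc₁ : ι c₁ ≠ 0 := fun h0 => by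
    rw [h0, zero_mul, zero_add] at hc hcx
    have : (x₂ - x₃) * w₃ = 0 := by linear_combination hcx - x₂ * hc
    simp [sub_eq_zero, h23, hw₃] at this
  have hc₂ : ι c₂ ≠ 0 := fun h0 => by
    rw [h0, zero_mul, add_zero] at hc hcx
    have : (x₁ - x₃) * w₃ = 0 := by linear_combination hcx - x₁ * hc
    simp [sub_eq_zero, h13, hw₃] at this
  -- rescale so that the third zero is the sum of the first two
  obtain ⟨u, hu0, hu⟩ : ∃ u : E, u ≠ 0 ∧ u = ι c₁ * w₁ := ⟨_, mul_ne_zero hc₁ hw₁, rfl⟩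
  obtain ⟨v, hv0, hv⟩ : ∃ v : E, v ≠ 0 ∧ v = ι c₂ * w₂ := ⟨_, mul_ne_zero hc₂ hw₂, rfl⟩
  have hux : u ^ q = x₁ * u := by rw [hu, mul_pow, hbar, hwx₁]; ring
  have hvx : v ^ q = x₂ * v := by rw [hv, mul_pow, hbar, hwx₂]; ring
  have hBu : B u u = 0 := (hmem x₁ u hx₁.1 hu0 hux).1 hx₁
  have hBv : B v v = 0 := (hmem x₂ v hx₂.1 hv0 hvx).1 hx₂
  -- Isotropy of u, v and u + v makes B antisymmetric on the pair.
  have hBuv : B u v + B v u = 0 := by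
    have h3 : B w₃ w₃ = 0 := (hmem x₃ w₃ hx₃.1 hw₃ hwx₃).1 hx₃
    have := hBexp 1 1 u v
    simp only [map_one, one_pow, one_mul] at this
    rw [show u + v = w₃ by rw [hu, hv, hc], h3, hBu, hBv] at this
    linear_combination -this
  have hBcd : ∀ c d : F, B (ι c * u + ι d * v) (ι c * u + ι d * v) =
      (ι c ^ Q * ι d - ι d ^ Q * ι c) * B u v := fun c d => by
    rw [hBexp, hBu, hBv]
    linear_combination (ι d ^ Q * ι c) * hBuv
  have hspan' := hspan x₁ x₂ u v hu0 hv0 h12 hux hvx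
  -- Otherwise every line would be isotropic, including the one over the non-zero `x₀`.
  have hB0 : B u v ≠ 0 := fun h0 => by
    obtain ⟨w, hw, hwx⟩ := hlift x₀ hx₀
    obtain ⟨c, d, hcd⟩ := hspan' w
    refine hx₀' ((hmem x₀ w hx₀ hw hwx).2 ?_)
    rw [← hcd, hBcd, h0, mul_zero]
  have hne : ∀ t : F, ι t * u + v ≠ 0 := fun t h0 => by
    have h1 : ι t * (x₁ * u) + x₂ * v = 0 := by
      rw [← hux, ← hvx, ← hbar t, ← mul_pow, ← haddq, h0, zero_pow hq0]
    have : (x₂ - x₁) * v = 0 := by linear_combination h1 - x₁ * h0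
    simp [sub_eq_zero, h12.symm, hv0] at this
  -- Affine chart of the projective line: `g t` is the unit circle point of the line through tu + v,
  -- and `x₁` is the point at infinity.
  let g : F → E := fun t => (ι t * (x₁ * u) + x₂ * v) / (ι t * u + v)
  have hg : ∀ t, (ι t * u + v) ^ q = g t * (ι t * u + v) := fun t => by
    rw [div_mul_cancel₀ _ (hne t), haddq, mul_pow, hbar, hux, hvx]
  have hgU : ∀ t, g t ^ (q + 1) = 1 := fun t => by
    have h1 : ((ι t * u + v) ^ q) ^ q = g t ^ (q + 1) * (ι t * u + v) := by
      conv_lhs => rw [hg t, mul_pow, hg t]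
      ring
    rw [hsq] at h1
    exact mul_right_cancel₀ (hne t) (by rw [← h1, one_mul])
  have hginj : Function.Injective g := fun t t' htt => by
    rw [div_eq_div_iff (hne t) (hne t')] at htt
    have : (ι t - ι t') * ((x₁ - x₂) * (u * v)) = 0 := by linear_combination htt
    have h3 : ι t = ι t' := by simpa [sub_eq_zero, h12, hu0, hv0] using this
    exact ι.injective h3
  have hgx₁ : ∀ t, g t ≠ x₁ := fun t ht => by
    rw [div_eq_iff (hne t)] at ht
    have : (x₁ - x₂) * v = 0 := by linear_combination -ht
    simp [sub_eq_zero, h12, hv0] at this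
  have hgz : ∀ t, g t ∈ unitCircleZeros q Q a b ↔ t ^ Q = t := fun t => by
    rw [hmem (g t) _ (hgU t) (hne t) (hg t)]
    have := hBcd t 1
    simp only [map_one, one_mul, mul_one, one_pow] at this
    rw [this, mul_eq_zero, or_iff_left hB0, sub_eq_zero, ← map_pow, ι.injective.eq_iff]
  have hset : unitCircleZeros q Q a b = insert x₁ (g '' {t : F | t ^ p ^ Nat.gcd i s = t}) := by
    have hgcd : {t : F | t ^ p ^ Nat.gcd i s = t} = {t : F | t ^ Q = t} := by
      ext t
      exact pow_gcd_eq_self_iff t (by rw [← hq, ← hF, FiniteField.pow_card])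
    rw [hgcd]
    ext x
    rw [Set.mem_insert_iff, Set.mem_image]
    constructor
    · intro hx
      by_cases hxx : x = x₁
      · exact Or.inl hxx
      obtain ⟨w, hw, hwx⟩ := hlift x hx.1
      obtain ⟨c, d, hcd⟩ := hspan' w
      have hcd' : ι c * (x₁ * u) + ι d * (x₂ * v) = x * w := by
        rw [← hwx, ← hcd, haddq, mul_pow, mul_pow, hbar, hbar, hux, hvx]
      have hd : ι d ≠ 0 := fun h0 => by
        rw [h0, zero_mul, add_zero] at hcd hcd'
        have : (x - x₁) * w = 0 := by linear_combination -hcd' + x₁ * hcd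
        simp [sub_eq_zero, hxx, hw] at this
      have hgt : g (c / d) = x := by
        rw [div_eq_iff (hne _), map_div₀]
        field_simp
        linear_combination hcd' - x * hcd
      exact Or.inr ⟨c / d, (hgz _).1 (hgt ▸ hx), hgt⟩
    · rintro (rfl | ⟨t, ht, rfl⟩)
      · exact hx₁
      · exact (hgz t).2 ht
  rw [hset, Set.ncard_insert_of_notMem, Set.ncard_image_of_injective _ hginj,
    ncard_pow_eq_self (Fact.out : p.Prime).one_lt (Nat.gcd_pos_of_pos_left s hi)
      (Nat.gcd_dvd_right i s) (hF.trans hq)]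
  rintro ⟨t, -, ht⟩
  exact hgx₁ t ht

end Quadratic

/-! ### Weights and zero counts -/

section Words

variable {F E : Type*} [Field F] [Fintype F] [Field E] [Algebra F E] {q : ℕ}

theorem algebraMap_trace_of_finrank_two (hF : Fintype.card F = q) (hE : Module.finrank F E = 2)
    (x : E) : algebraMap F E (Algebra.trace F E x) = x + x ^ q := by
  have hfd : FiniteDimensional F E := .of_finrank_pos (by omega)
  have hfin : Finite E := Module.finite_of_finite F
  rw [FiniteField.algebraMap_trace_eq_sum_pow, hE, Nat.card_eq_fintype_card, hF]
  simp [Finset.sum_range_succ]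

theorem traceWord_eq_zero_iff (hF : Fintype.card F = q) (hE : Module.finrank F E = 2)
    {β : E} (hβ : β ^ (q + 1) = 1) (hadd : ∀ x y : E, (x + y) ^ q = x ^ q + y ^ q)
    (h : ℕ) (a b : E) (j : Fin (q + 1)) :
    traceWord F β (q + 1) h (a, b) j = 0 ↔
      β ^ (j : ℕ) ∈ unitCircleZeros q (2 * h + 1) a b := by
  have hx : (β ^ (j : ℕ)) ^ (q + 1) = 1 := by rw [pow_right_comm, hβ, one_pow]
  have hx0 : β ^ (j : ℕ) ≠ 0 := fun h0 => by simp [h0] at hx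
  rw [← map_eq_zero_iff _ (algebraMap F E).injective, traceWord_apply,
    algebraMap_trace_of_finrank_two hF hE, unitCircleZeros, Set.mem_ofPred_eq,
    and_iff_right hx]
  generalize β ^ (j : ℕ) = x at *
  -- Since x^q = 1/x, the factor x^(h+1) clears the negative exponents of the trace.
  have key : b * x ^ (2 * h + 1 + 1) + a * x ^ (2 * h + 1) + a ^ q * x + b ^ q =
      x ^ (h + 1) * (a * x ^ h + b * x ^ (h + 1) + (a * x ^ h + b * x ^ (h + 1)) ^ q) := by
    have h1 : x ^ (h + 1) * (x ^ h) ^ q = x := by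
      calc _ = (x ^ (q + 1)) ^ h * x := by ring
        _ = x := by rw [hx, one_pow, one_mul]
    have h2 : x ^ (h + 1) * (x ^ (h + 1)) ^ q = 1 := by
      calc _ = (x ^ (q + 1)) ^ (h + 1) := by ring
        _ = 1 := by rw [hx, one_pow]
    rw [hadd, mul_pow, mul_pow]
    linear_combination -(a ^ q) * h1 - b ^ q * h2
  rw [key, mul_eq_zero, or_iff_right (pow_ne_zero _ hx0)]

theorem hammingNorm_traceWord_add_ncard [DecidableEq F] (hF : Fintype.card F = q)
    (hE : Module.finrank F E = 2) {β : E} (hβ : IsPrimitiveRoot β (q + 1))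
    (hadd : ∀ x y : E, (x + y) ^ q = x ^ q + y ^ q) (h : ℕ) (a b : E) :
    hammingNorm (traceWord F β (q + 1) h (a, b)) +
      (unitCircleZeros q (2 * h + 1) a b).ncard = q + 1 := by
  have hinj : Function.Injective fun j : Fin (q + 1) => β ^ (j : ℕ) := fun j k hjk =>
    Fin.ext (hβ.pow_inj j.2 k.2 hjk)
  have himg : unitCircleZeros q (2 * h + 1) a b = (fun j : Fin (q + 1) => β ^ (j : ℕ)) ''
      (Finset.univ.filter fun j => traceWord F β (q + 1) h (a, b) j = 0 : Finset _) := by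
    ext x
    simp only [Finset.coe_filter, Finset.mem_univ, true_and, Set.mem_image, Set.mem_ofPred_eq,
      traceWord_eq_zero_iff hF hE hβ.pow_eq_one hadd]
    constructor
    · intro hx
      obtain ⟨k, hk, rfl⟩ := hβ.eq_pow_of_pow_eq_one hx.1
      exact ⟨⟨k, hk⟩, hx, rfl⟩
    · rintro ⟨j, hj, rfl⟩
      exact hj
  rw [himg, Set.ncard_image_of_injective _ hinj, Set.ncard_coe_finset, hammingNorm, add_comm]
  simpa using Finset.card_filter_add_card_filter_not (s := Finset.univ)
    (fun j : Fin (q + 1) => traceWord F β (q + 1) h (a, b) j = 0)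

end Words

/-! ### All four zero counts occur -/

section Zeros

variable {F E : Type*} [Field F] [Fintype F] [Field E] [Algebra F E] {p s i q : ℕ}
  [Fact p.Prime] [CharP E p]

theorem IsPrimitiveRoot.pow_ne_self {M : Type*} [CommMonoid M] {β : M} {q : ℕ}
    (hq : 1 < q) (hβ : IsPrimitiveRoot β (q + 1)) : β ^ q ≠ β := fun h => by
  have := hβ.pow_inj (i := q) (j := 1) (by omega) (by omega) (by rw [h, pow_one])
  omega

/-- Choosing b^q = -y^Q b, where Q = p^i, makes the polynomial factor as b (x+1) (x-y)^Q. Taking y =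
-1 later gives a single zero. -/
theorem exists_unitCircleZeros_eq_pair (hp : Odd p) (hq : q = p ^ s)
    (hsq : ∀ w : E, (w ^ q) ^ q = w) {β : E} (hβ : β ^ q ≠ β) (i : ℕ) {y : E}
    (hy : y ^ (q + 1) = 1) : ∃ b : E, b ≠ 0 ∧ unitCircleZeros q (p ^ i) b b = {-1, y} := by
  have hqodd : Odd q := hq ▸ hp.pow
  have hu : (-y ^ p ^ i) ^ (q + 1) = 1 := by
    rw [hqodd.add_one.neg_pow, pow_right_comm, hy, one_pow]
  obtain ⟨b, hb, hbu⟩ := exists_pow_eq_mul hq hsq hβ hu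
  refine ⟨b, hb, ?_⟩
  ext x
  have hfac : b * x ^ (p ^ i + 1) + b * x ^ p ^ i + b ^ q * x + b ^ q =
      (x + 1) * b * (x - y) ^ p ^ i := by
    rw [sub_pow_char_pow, hbu]
    ring
  rw [unitCircleZeros, Set.mem_ofPred_eq, hfac, Set.mem_insert_iff, Set.mem_singleton_iff,
    mul_eq_zero, mul_eq_zero, or_iff_left hb, add_eq_zero_iff_eq_neg,
    pow_eq_zero_iff (pow_pos (Fact.out : p.Prime).pos i).ne', sub_eq_zero]
  refine and_iff_right_of_imp ?_
  rintro (rfl | rfl)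
  · rw [hqodd.add_one.neg_one_pow]
  · exact hy

/-- Choosing b^q = -βb reduces the equation to x^(p^i+1) = β. The exponent is even, whereas a
generator of the group of (q+1)-th roots of unity, of even order, is not a square in it. -/
theorem exists_unitCircleZeros_eq_empty (hp : Odd p) (hq : q = p ^ s)
    (hsq : ∀ w : E, (w ^ q) ^ q = w) {β : E} (hβ : IsPrimitiveRoot β (q + 1)) (hβ' : β ^ q ≠ β)
    (i : ℕ) : ∃ b : E, b ≠ 0 ∧ unitCircleZeros q (p ^ i) 0 b = ∅ := by
  have hqodd : Odd q := hq ▸ hp.pow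
  obtain ⟨k, hk⟩ : Even (q + 1) := hqodd.add_one
  obtain ⟨l, hl⟩ : Even (p ^ i + 1) := hp.pow.add_one
  have hu : (-β) ^ (q + 1) = 1 := by rw [hqodd.add_one.neg_pow, hβ.pow_eq_one]
  obtain ⟨b, hb, hbu⟩ := exists_pow_eq_mul hq hsq hβ' hu
  refine ⟨b, hb, Set.eq_empty_of_forall_notMem fun x hx => ?_⟩
  have hxβ : x ^ (p ^ i + 1) = β := by
    have h0 := hx.2
    rw [zero_pow (by have := hqodd.pos; omega), hbu] at h0
    refine mul_left_cancel₀ hb ?_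
    linear_combination h0
  refine hβ.pow_ne_one_of_pos_of_lt (l := k) (by omega) (by omega) ?_
  calc β ^ k = (x ^ (q + 1)) ^ l := by rw [← hxβ, ← pow_mul, ← pow_mul, hk, hl]; ring
    _ = 1 := by rw [hx.1, one_pow]

/-- Vanishing at 1, β, β² imposes three F-linear conditions on the 4-dimensional space of pairs (a,
b). -/
theorem exists_two_lt_ncard_unitCircleZeros (hF : Fintype.card F = q)
    (hE : Module.finrank F E = 2) (hq : q = p ^ s) (hq1 : 1 < q) {β : E}
    (hβ : IsPrimitiveRoot β (q + 1)) (h : ℕ) :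
    ∃ a b : E, (a, b) ≠ 0 ∧ 2 < (unitCircleZeros q (2 * h + 1) a b).ncard := by
  have hfd : FiniteDimensional F E := .of_finrank_pos (by omega)
  have hfin : Finite E := Module.finite_of_finite F
  have hadd : ∀ x y : E, (x + y) ^ q = x ^ q + y ^ q := fun x y => by
    rw [hq, add_pow_char_pow]
  let e : Fin 3 → Fin (q + 1) := Fin.castLE (by omega)
  have hker : LinearMap.ker ((LinearMap.funLeft F F e).comp (traceWord F β (q + 1) h)) ≠ ⊥ :=
    LinearMap.ker_ne_bot_of_finrank_lt (by simp [hE])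
  obtain ⟨⟨a, b⟩, hab, hab0⟩ := (Submodule.ne_bot_iff _).1 hker
  refine ⟨a, b, hab0, ?_⟩
  have hz : ∀ j : Fin 3, β ^ (j : ℕ) ∈ unitCircleZeros q (2 * h + 1) a b := fun j =>
    (traceWord_eq_zero_iff hF hE hβ.pow_eq_one hadd h a b (e j)).1 (congrFun hab j)
  have hne : ∀ j k : Fin 3, j ≠ k → β ^ (j : ℕ) ≠ β ^ (k : ℕ) := fun j k hjk heq =>
    hjk (Fin.ext (hβ.pow_inj (by omega) (by omega) heq))
  exact (Set.two_lt_ncard (Set.toFinite _)).2 ⟨_, hz 0, _, hz 1, _, hz 2, hne 0 1 (by decide),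
    hne 0 2 (by decide), hne 1 2 (by decide)⟩

end Zeros

/-! ### The weight distribution and parameters -/

theorem mainTheorem2 {F E : Type*} [Field F] [Fintype F] [DecidableEq F] [Field E] [Algebra F E]
    (p s i m q h : ℕ) (hp : p.Prime) (hp_odd : Odd p)
    (hs : 1 < s) (hi : 0 < i) (his : i < s) (hm : m = Nat.gcd i s)
    (hq : q = p ^ s) (hh : h = (p ^ i - 1) / 2)
    (hF : Fintype.card F = q) (hE : Module.finrank F E = 2)
    (β : E) (hβ : IsPrimitiveRoot β (q + 1)) :
    IsWeightCode 4 (dualCode (bchCode F β (q + 1) 3 h)) ∧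
      HasParameters (dualCode (bchCode F β (q + 1) 3 h)) 4 (q - p ^ m) := by
  have : Fact p.Prime := ⟨hp⟩
  have hfd : FiniteDimensional F E := .of_finrank_pos (by omega)
  have hfin : Finite E := Module.finite_of_finite F
  have hcharF : CharP F p := charP_of_card_eq_prime_pow (hF.trans hq)
  have hcharE : CharP E p := charP_of_injective_algebraMap (algebraMap F E).injective p
  have hadd : ∀ x y : E, (x + y) ^ q = x ^ q + y ^ q := fun x y => by
    rw [hq, add_pow_char_pow]
  have hsq := pow_card_sq_eq_self (E := E) hF hE
  have hp2 : 2 < p := by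
    have := hp.two_le
    obtain ⟨k, rfl⟩ := hp_odd
    omega
  have hm0 : 0 < m := hm ▸ Nat.gcd_pos_of_pos_left s hi
  have hmi : m ≤ i := hm ▸ Nat.gcd_le_left s hi
  have hpm : 2 < p ^ m := hp2.trans_le (Nat.le_self_pow hm0.ne' p)
  have hmiQ : p ^ m ≤ p ^ i := Nat.pow_le_pow_right hp.pos hmi
  have hQq : p ^ i < q := hq ▸ Nat.pow_lt_pow_right hp.one_lt his
  have hβ' := hβ.pow_ne_self (by omega)
  have hQ : 2 * h + 1 = p ^ i := by
    obtain ⟨k, hk⟩ := hp_odd.pow (n := i)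
    omega
  have hcount := hammingNorm_traceWord_add_ncard hF hE hβ hadd h
  rw [hQ] at hcount
  have hle : ∀ a b : E, (a, b) ≠ 0 → (unitCircleZeros q (p ^ i) a b).ncard ≤ p ^ i + 1 :=
    fun a b hab => ncard_unitCircleZeros_le (by omega) hab
  have hne : ∀ a b : E, (a, b) ≠ 0 → traceWord F β (q + 1) h (a, b) ≠ 0 := fun a b hab => by
    have h1 := hcount a b
    have h2 := hle a b hab
    rw [← hammingNorm_ne_zero_iff]
    omega
  have hmany : ∀ a b : E, (a, b) ≠ 0 → 2 < (unitCircleZeros q (p ^ i) a b).ncard →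
      (unitCircleZeros q (p ^ i) a b).ncard = p ^ m + 1 := fun a b hab h2 => by
    -- A nonzero entry of the word supplies the unit circle point that is not a zero.
    obtain ⟨j, hj⟩ := Function.ne_iff.1 (hne a b hab)
    rw [Pi.zero_apply, Ne, traceWord_eq_zero_iff hF hE hβ.pow_eq_one hadd, hQ] at hj
    rw [hm]
    exact ncard_unitCircleZeros_of_two_lt hi hq hF hE hβ' h2
      (by rw [pow_right_comm, hβ.pow_eq_one, one_pow]) hj
  rw [dualCode_bchCode_three hβ.pow_eq_one]
  have hweights : nonzeroWeights (LinearMap.range (traceWord F β (q + 1) h)) =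
      ({q + 1, q, q - 1, q - p ^ m} : Finset ℕ) := by
    ext w
    simp only [Finset.coe_insert, Finset.coe_singleton, Set.mem_insert_iff, Set.mem_singleton_iff]
    have hattain : ∀ a b : E, (a, b) ≠ 0 →
        w + (unitCircleZeros q (p ^ i) a b).ncard = q + 1 →
        w ∈ nonzeroWeights (LinearMap.range (traceWord F β (q + 1) h)) := fun a b hab hw =>
      ⟨_, ⟨(a, b), rfl⟩, hne a b hab, by have := hcount a b; omega⟩
    constructor
    · rintro ⟨_, ⟨⟨a, b⟩, rfl⟩, hc, rfl⟩
      have hab : (a, b) ≠ 0 := fun h0 => hc (by rw [h0, map_zero])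
      have h1 := hcount a b
      by_cases h2 : 2 < (unitCircleZeros q (p ^ i) a b).ncard
      · have := hmany a b hab h2
        omega
      · omega
    · rintro (rfl | rfl | rfl | rfl)
      · obtain ⟨b, hb, hz⟩ := exists_unitCircleZeros_eq_empty hp_odd hq hsq hβ hβ' i
        exact hattain 0 b (by simp [hb]) (by rw [hz, Set.ncard_empty])
      · obtain ⟨b, hb, hz⟩ := exists_unitCircleZeros_eq_pair hp_odd hq hsq hβ' i
          (y := (-1 : E)) (by rw [(hq ▸ hp_odd.pow : Odd w).add_one.neg_one_pow])
        exact hattain b b (by simp [hb]) (by rw [hz, Set.pair_eq_singleton, Set.ncard_singleton])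
      · obtain ⟨b, hb, hz⟩ := exists_unitCircleZeros_eq_pair hp_odd hq hsq hβ' i hβ.pow_eq_one
        have hβ1 : -1 ≠ β := by
          rintro rfl
          exact hβ' (hq ▸ hp_odd.pow : Odd q).neg_one_pow
        refine hattain b b (by simp [hb]) ?_
        rw [hz, Set.ncard_pair hβ1]
        omega
      · obtain ⟨a, b, hab, h2⟩ :=
          exists_two_lt_ncard_unitCircleZeros hF hE hq (by omega) hβ h
        rw [hQ] at h2
        refine hattain a b hab ?_
        rw [hmany a b hab h2]
        omega
  refine ⟨?_, ?_, ?_⟩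
  · rw [IsWeightCode, hweights, Set.ncard_coe_finset]
    -- The bounds 2 < p^m ≤ p^i < q keep the subtractions exact and the four weights distinct.
    have h1 : q + 1 ∉ ({q, q - 1, q - p ^ m} : Finset ℕ) := by
      simp only [Finset.mem_insert, Finset.mem_singleton]
      omega
    have h2 : q ∉ ({q - 1, q - p ^ m} : Finset ℕ) := by
      simp only [Finset.mem_insert, Finset.mem_singleton]
      omega
    rw [Finset.card_insert_of_notMem h1, Finset.card_insert_of_notMem h2,
      Finset.card_pair (by omega)]
  · have hinj : Function.Injective (traceWord F β (q + 1) h) := by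
      rw [injective_iff_map_eq_zero]
      rintro ⟨a, b⟩ h0
      by_contra hab
      exact hne a b hab h0
    rw [LinearMap.finrank_range_of_inj hinj, Module.finrank_prod, hE]
  · rw [hweights]
    refine ⟨by simp, fun w hw => ?_⟩
    simp only [Finset.coe_insert, Finset.coe_singleton, Set.mem_insert_iff,
      Set.mem_singleton_iff] at hw
    omega
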